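/- Let $m \ge 1$ and let $w_0 = m \cdots 2\,1 \in S_m$ be the longest permutation, $w_0(i) = m+1-i$. For $w \in S_m$ a reduced word for $w$ is a sequence $a = (a_1, \dots, a_\ell)$ with $1 \le a_j \le m-1$, where $\ell = \ell(w)$ is the length (number of inversions) of $w$, such that $w = s_{a_1} s_{a_2} \cdots s_{a_\ell}$; here $s_i$ is the transposition of $i$ and $i+1$. Stanley's symmetric function of $w$ is the power series \[ F_w(x) = \sum_{a} \ \sum_{i} x_{i_1} x_{i_2} \cdots x_{i_\ell} \] in infinitely many variables $x_1, x_2, \dots$, where $a$ runs over the reduced words for $w$, and $i$ runs over the sequences of integers $1 \le i_1 \le i_2 \le \cdots \le i_\ell$ such that $i_j < i_{j+1}$ whenever $a_j > a_{j+1}$. For a partition $\lambda$ let $s_\lambda(x) = \sum_T x^T$ be the Schur function, the sum being over all semistandard Young tableaux $T$ of shape $\lambda$. Then $F_{w_0}$ is equal to the Schur function of the staircase partition: \[ F_{w_0}(x) = s_{(m-1, m-2, \dots, 2, 1)}(x) . \] Moreover, the number of reduced words for $w_0$ is equal to the number of standard Young tableaux of shape $(m-1, m-2, \dots, 2, 1)$.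 -/

import Mathlib

namespace StanleySym

/-- The simple reflection of `S_m` interchanging the consecutive elements `i` and `i + 1`
of `Fin m = {0, …, m - 1}`. -/
def simpleReflection {m : ℕ} (i : Fin (m - 1)) : Equiv.Perm (Fin m) :=
  Equiv.swap ⟨i.val, by omega⟩ ⟨i.val + 1, by omega⟩

/-- The length `ℓ(w)` of a permutation, i.e. its number of inversions. -/
def length {m : ℕ} (w : Equiv.Perm (Fin m)) : ℕ :=
  (Finset.univ.filter fun p : Fin m × Fin m => p.1 < p.2 ∧ w p.2 < w p.1).card

/-- The word `a = (a_1, …, a_ℓ)`, standing for the tuple `(s_{a_1}, …, s_{a_ℓ})` of simple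
reflections, is a reduced word for `w`: `w = s_{a_1} ⋯ s_{a_ℓ}` (product of functions under
composition) and `ℓ = ℓ(w)`. -/
def IsReducedWord {m : ℕ} (w : Equiv.Perm (Fin m)) (a : List (Fin (m - 1))) : Prop :=
  (a.map simpleReflection).prod = w ∧ a.length = length w

/-- The sequence `i` is compatible with the word `a`: they have the same length,
`i_1 ≤ i_2 ≤ ⋯ ≤ i_ℓ`, and `i_j < i_{j+1}` at each descent `a_j > a_{j+1}` of `a`. -/
def IsCompatible {n : ℕ} (a : List (Fin n)) (i : List ℕ) : Prop :=
  i.length = a.length ∧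
    ∀ (j : ℕ) (ha : j + 1 < a.length) (hi : j + 1 < i.length),
      i[j] ≤ i[j + 1] ∧ (a[j + 1] < a[j] → i[j] < i[j + 1])

/-- The exponent of the monomial `x_{i_1} x_{i_2} ⋯ x_{i_ℓ}`. -/
noncomputable def exponent (i : List ℕ) : ℕ →₀ ℕ :=
  (i.map fun k => Finsupp.single k 1).sum

/-- Stanley's symmetric function
`F_w = ∑_a ∑_i x_{i_1} x_{i_2} ⋯ x_{i_ℓ}`,
over the reduced words `a` for `w` and the sequences `i` compatible with `a`, as a power series
in infinitely many variables, indexed by `ℕ`. The coefficient of `x^d` is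
the (finite) number of pairs `(a, i)` that contribute the monomial `x^d`. -/
noncomputable def stanleyF {m : ℕ} (w : Equiv.Perm (Fin m)) : MvPowerSeries ℕ ℤ :=
  fun d => (Nat.card {p : List (Fin (m - 1)) × List ℕ //
    IsReducedWord w p.1 ∧ IsCompatible p.1 p.2 ∧ exponent p.2 = d} : ℤ)

/-- The exponent of the monomial `x^T = ∏ x_{T(c)}` (over the cells `c` of the tableau `T`). -/
noncomputable def content {μ : YoungDiagram} (T : SemistandardYoungTableau μ) : ℕ →₀ ℕ :=
  ∑ c ∈ μ.cells, Finsupp.single (T c.1 c.2) 1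

/-- The Schur function `s_μ = ∑_T x^T`, over the semistandard tableaux `T` of shape `μ`,
as a power series in infinitely many variables, indexed by `ℕ`. The coefficient of `x^d` is the
(finite) number of tableaux of shape `μ` and content `d`. -/
noncomputable def schurFunction (μ : YoungDiagram) : MvPowerSeries ℕ ℤ :=
  fun d => (Nat.card {T : SemistandardYoungTableau μ // content T = d} : ℤ)

/-- A standard tableau of shape `μ`: a semistandard tableau whose entries are
`0, 1, …, |μ| - 1`, each occurring exactly once (so `0` plays the role of the usual `1`). -/
abbrev StandardTableau (μ : YoungDiagram) : Type :=
  {T : SemistandardYoungTableau μ //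
    Set.BijOn (fun c : ℕ × ℕ => T c.1 c.2) (μ.cells : Set (ℕ × ℕ)) (Set.Iio μ.card)}

/-- The longest permutation `w₀ = m ⋯ 2 1` of `S_m`, i.e. `i ↦ m - 1 - i` on `{0, …, m - 1}`. -/
def longestPerm (m : ℕ) : Equiv.Perm (Fin m) := Fin.revPerm

/-- The Young diagram of the staircase partition `(m - 1, m - 2, …, 2, 1)`. -/
def staircase (m : ℕ) : YoungDiagram where
  cells := (Finset.range m ×ˢ Finset.range m).filter fun c => c.1 + c.2 + 1 < m
  isLowerSet := by
    rintro ⟨i, j⟩ ⟨i', j'⟩ ⟨h1, h2⟩ h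
    simp only [Finset.coe_filter, Finset.mem_product, Finset.mem_range, Set.mem_ofPred_eq] at h ⊢
    simp only at h1 h2
    omega

/-- Row `i` of the staircase (counted from `0`) has `m - 1 - i` boxes. -/
theorem rowLen_staircase (m i : ℕ) : (staircase m).rowLen i = m - 1 - i := by
  have key : ∀ j, j < (staircase m).rowLen i ↔ j < m - 1 - i := by
    intro j
    rw [← YoungDiagram.mem_iff_lt_rowLen, ← YoungDiagram.mem_cells]
    simp only [staircase, Finset.mem_filter, Finset.mem_product, Finset.mem_range]
    omega
  have h1 := key ((staircase m).rowLen i)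
  have h2 := key (m - 1 - i)
  omega

/-- Only finitely many pairs contribute to a coefficient of `F_w`. -/
theorem finite_stanleyF {m : ℕ} (w : Equiv.Perm (Fin m)) (d : ℕ →₀ ℕ) :
    Finite {p : List (Fin (m - 1)) × List ℕ //
      IsReducedWord w p.1 ∧ IsCompatible p.1 p.2 ∧ exponent p.2 = d} := by
  have h1 : {a : List (Fin (m - 1)) | a.length = length w}.Finite := List.finite_length_eq _ _
  have h2 : {i : List ℕ | exponent i = d}.Finite := by
    have hm : ∀ i : List ℕ, exponent i = Multiset.toFinsupp (i : Multiset ℕ) := by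
      intro i
      induction i with
      | nil => simp [exponent]
      | cons k i ih =>
        rw [← Multiset.cons_coe, ← Multiset.singleton_add, map_add, ← ih,
          Multiset.toFinsupp_singleton]
        simp [exponent]
    by_cases he : ∃ i₀, exponent i₀ = d
    · obtain ⟨i₀, hi₀⟩ := he
      refine (List.finite_toSet i₀.permutations).subset fun i hi => ?_
      have : (i : Multiset ℕ) = i₀ := by
        apply Multiset.toFinsupp.injective
        rw [← hm, ← hm, hi₀]; exact hi
      exact List.mem_permutations.2 (Multiset.coe_eq_coe.1 this)
    · convert Set.finite_empty
      ext i
      simpa using fun hi => he ⟨i, hi⟩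
  exact ((h1.prod h2).subset fun p hp => ⟨hp.1.2, hp.2.2⟩).to_subtype

/-- Only finitely many tableaux contribute to a coefficient of a Schur function. -/
theorem finite_schurFunction (μ : YoungDiagram) (d : ℕ →₀ ℕ) :
    Finite {T : SemistandardYoungTableau μ // content T = d} := by
  have hmem : ∀ T : SemistandardYoungTableau μ, content T = d →
      ∀ c : μ.cells, T c.1.1 c.1.2 ∈ d.support := by
    rintro T rfl c
    rw [Finsupp.mem_support_iff, content, Finsupp.finsetSum_apply]
    intro h
    have := (Finset.sum_eq_zero_iff.1 h) c.1 c.2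
    simp at this
  refine Finite.of_injective
    (fun T : {T : SemistandardYoungTableau μ // content T = d} =>
      fun c : μ.cells => (⟨T.1 c.1.1 c.1.2, hmem T.1 T.2 c⟩ : d.support)) ?_
  intro T T' h
  apply Subtype.ext
  ext i j
  by_cases hc : (i, j) ∈ μ
  · have := congrFun h ⟨(i, j), hc⟩
    simpa using this
  · rw [T.1.zeros hc, T'.1.zeros hc]

end StanleySym

/-!
Both sides satisfy the bialternant formula for the staircase partition, in finitely many variables
`x_0, …, x_{N-1}`: the product of each of them with the Vandermonde alternant `det (x_i ^ (N-1-j))`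
is `det (x_i ^ (λ_j + N-1-j))`, where `λ_j = m - 1 - j` (truncated at `0`). As polynomials over `ℤ`
have no zero divisors, the two sides agree.

*Stanley's series.* In the nilCoxeter algebra, realized by the matrices `nilGen` indexed by `S_m`,
let `A_k(x) = (1 + x u_0) ⋯ (1 + x u_{k-1})`. As neighbouring letters of a reduced word are
distinct, the pairs of a reduced word of `w` and a compatible sequence are the strictly increasing
lists in a lexicographic order, so that `F_w(x_0, …, x_{N-1})` is the entry `(1, w)` of
`A_{m-1}(x_0) ⋯ A_{m-1}(x_{N-1})` (`stanleyF_eq_coeff`). By the Yang–Baxter equation, `A_k(x)` and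
`A_k(y)` commute (`NilCoxeterRel.ascProd_comm`). From
`A_k(y) = A_{k+1}(y) - y A_{k+1}(y) u_k` it follows that, after multiplication with
`∏ x_j ^ (N-1-j)` and antisymmetrization, a pair of neighbouring factors `A_{k+1}(x_i) A_k(x_{i+1})`
may be replaced by `A_{k+1}(x_i) A_{k+1}(x_{i+1})`: the difference is symmetric in `x_i`, `x_{i+1}`
(`NilCoxeterRel.alternate_raise`). Hence the product `A_{m-1}(x_0) A_{m-2}(x_1) A_{m-3}(x_2) ⋯` has
the same antisymmetrization as `A_{m-1}(x_0) A_{m-1}(x_1) ⋯`. The former has as many letters as `w₀`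
has inversions, so its entry at `w₀` is the single monomial `∏ x_j ^ (m-1-j)`
(`orderedProd_staircase_apply`), while the latter is symmetric and comes out of the
antisymmetrization as `F_{w₀}` times the Vandermonde alternant (`alternant_mul_orderedProd_apply`).

*Schur functions.* Column operations give a branching rule for alternants (`alternant_succ`), a sum
over the sequences interlacing the given one. Semistandard tableaux satisfy the same
branching rule: the boxes of the largest entry are removed (`bijective_fillStrip`). The
bialternant formula follows by induction on the number of variables (`alternant_mul_schurPoly`).

The count of reduced words is the comparison of the coefficients of `x_0 x_1 ⋯ x_{ℓ-1}`, where
`ℓ` is the common value of the length of `w₀` and the size of the staircase.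
-/

namespace StanleySym

/-! ### The nilCoxeter relations and the Yang–Baxter equation -/

section Algebra

variable {R E : Type*} [CommRing R] [Ring E] [Algebra R E]

/-- The relations of the nilCoxeter algebra of type `A`. -/
structure NilCoxeterRel (u : ℕ → E) : Prop where
  sq : ∀ c, u c * u c = 0
  comm : ∀ c d, c + 2 ≤ d → u c * u d = u d * u c
  braid : ∀ c, u c * u (c + 1) * u c = u (c + 1) * u c * u (c + 1)

/-- The factor `1 + x u_c`. -/
def nilFactor (u : ℕ → E) (c : ℕ) (x : R) : E := 1 + x • u c

/-- The product `(1 + x u_0) (1 + x u_1) ⋯ (1 + x u_{k-1})`. -/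
def ascProd (u : ℕ → E) (k : ℕ) (x : R) : E :=
  ((List.range k).map fun c => nilFactor u c x).prod

theorem ascProd_zero (u : ℕ → E) (x : R) : ascProd u 0 x = 1 := by simp [ascProd]

theorem ascProd_succ (u : ℕ → E) (k : ℕ) (x : R) :
    ascProd u (k + 1) x = ascProd u k x * nilFactor u k x := by
  simp [ascProd, List.range_succ]

variable {u : ℕ → E}

theorem NilCoxeterRel.factor_mul_factor (hu : NilCoxeterRel u) (c : ℕ) (x y : R) :
    nilFactor u c x * nilFactor u c y = nilFactor u c (x + y) := by
  simp only [nilFactor, mul_add, add_mul, one_mul, mul_one, smul_mul_smul_comm, hu.sq, smul_zero,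
    add_smul]
  abel

/-- The Yang–Baxter equation for the factors `1 + x u_c`. -/
theorem NilCoxeterRel.yangBaxter (hu : NilCoxeterRel u) (c : ℕ) (x y : R) :
    nilFactor u (c + 1) x * nilFactor u c y * nilFactor u (c + 1) (y - x) =
      nilFactor u c (y - x) * nilFactor u (c + 1) y * nilFactor u c x := by
  simp only [nilFactor, mul_add, add_mul, one_mul, mul_one, smul_mul_smul_comm, hu.sq, smul_zero,
    hu.braid c]
  module

theorem NilCoxeterRel.factor_comm_ascProd (hu : NilCoxeterRel u) (k d : ℕ) (hd : k + 1 ≤ d)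
    (x y : R) : nilFactor u d x * ascProd u k y = ascProd u k y * nilFactor u d x := by
  induction k with
  | zero => simp [ascProd_zero]
  | succ k ih =>
    have h : nilFactor u d x * nilFactor u k y = nilFactor u k y * nilFactor u d x := by
      simp only [nilFactor, mul_add, add_mul, one_mul, mul_one, smul_mul_smul_comm,
        hu.comm k d (by omega), mul_comm x y]
      abel
    rw [ascProd_succ, ← mul_assoc, ih (by omega), mul_assoc, h, mul_assoc]

theorem NilCoxeterRel.ascProd_succ_mul_factor_neg (hu : NilCoxeterRel u) (k : ℕ) (x : R) :
    ascProd u (k + 1) x * nilFactor u k (-x) = ascProd u k x := by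
  rw [ascProd_succ, mul_assoc, hu.factor_mul_factor]
  simp [nilFactor]

/-- The products `(1 + x u_0) ⋯ (1 + x u_{k-1})` and `(1 + y u_0) ⋯ (1 + y u_{k-1})` commute;
this is why Stanley's series is symmetric. -/
theorem NilCoxeterRel.ascProd_comm (hu : NilCoxeterRel u) (k : ℕ) (x y : R) :
    ascProd u k x * ascProd u k y = ascProd u k y * ascProd u k x := by
  induction k with
  | zero => simp [ascProd_zero]
  | succ k ih =>
    cases k with
    | zero =>
      simp only [ascProd_succ, ascProd_zero, one_mul, hu.factor_mul_factor, add_comm]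
    | succ k =>
      have yb : nilFactor u (k + 1) x * nilFactor u k y * nilFactor u (k + 1) y =
          nilFactor u k (-x + y) * nilFactor u (k + 1) y * nilFactor u k x *
            nilFactor u (k + 1) x := by
        rw [neg_add_eq_sub, ← hu.yangBaxter, mul_assoc _ _ (nilFactor u (k + 1) x),
          hu.factor_mul_factor, sub_add_cancel]
      calc ascProd u (k + 2) x * ascProd u (k + 2) y
          = ascProd u (k + 1) x * (nilFactor u (k + 1) x * ascProd u k y) *
              (nilFactor u k y * nilFactor u (k + 1) y) := by
            rw [ascProd_succ u (k + 1) x, ascProd_succ u (k + 1) y, ascProd_succ u k y]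
            simp only [mul_assoc]
        _ = ascProd u (k + 1) x * ascProd u k y *
              (nilFactor u (k + 1) x * nilFactor u k y * nilFactor u (k + 1) y) := by
            rw [hu.factor_comm_ascProd k (k + 1) le_rfl]; simp only [mul_assoc]
        _ = ascProd u (k + 1) x * (ascProd u k y * nilFactor u k y) * nilFactor u k (-x) *
              (nilFactor u (k + 1) y * nilFactor u k x * nilFactor u (k + 1) x) := by
            rw [yb, add_comm (-x) y, ← hu.factor_mul_factor]; simp only [mul_assoc]
        _ = ascProd u (k + 1) y * (ascProd u (k + 1) x * nilFactor u k (-x)) *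
              (nilFactor u (k + 1) y * nilFactor u k x * nilFactor u (k + 1) x) := by
            rw [← ascProd_succ, ih]; simp only [mul_assoc]
        _ = ascProd u (k + 1) y * (nilFactor u (k + 1) y * ascProd u k x) *
              (nilFactor u k x * nilFactor u (k + 1) x) := by
            rw [hu.ascProd_succ_mul_factor_neg, hu.factor_comm_ascProd k (k + 1) le_rfl]
            simp only [mul_assoc]
        _ = ascProd u (k + 2) y * ascProd u (k + 2) x := by
            rw [ascProd_succ u (k + 1) x, ascProd_succ u (k + 1) y, ascProd_succ u k x]
            simp only [mul_assoc]

end Algebra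

/-! ### Antisymmetrization of ordered products -/

section Alternation

variable {R E : Type*} [Ring E] {N : ℕ}

/-- The antisymmetrization `∑_σ sgn(σ) f(x_{σ(0)}, …, x_{σ(N-1)})` of a function `f` of `N`
variables. -/
def alternate (f : (Fin N → R) → E) (x : Fin N → R) : E :=
  ∑ σ : Equiv.Perm (Fin N), Equiv.Perm.sign σ • f (x ∘ σ)

theorem alternate_sub (f g : (Fin N → R) → E) (x : Fin N → R) :
    alternate (fun x => f x - g x) x = alternate f x - alternate g x := by
  simp [alternate, smul_sub]

/-- The antisymmetrization of a function that is symmetric in two of its variables vanishes. -/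
theorem alternate_eq_zero (f : (Fin N → R) → E) (i j : Fin N) (hij : i ≠ j)
    (hf : ∀ x, f (x ∘ Equiv.swap i j) = f x) (x : Fin N → R) : alternate f x = 0 := by
  refine Finset.sum_involution (fun σ _ => σ * Equiv.swap i j) ?_ ?_ (by simp) ?_
  · intro σ _
    have : x ∘ (σ * Equiv.swap i j : Equiv.Perm (Fin N)) = (x ∘ σ) ∘ Equiv.swap i j := rfl
    rw [this, hf]
    simp [Equiv.Perm.sign_swap hij]
  · intro σ _ _ h
    exact hij (Equiv.swap_eq_one_iff.1 (by simpa using h))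
  · intro σ _
    simp [mul_assoc]

/-- The ordered product `φ_0(x_0) φ_1(x_1) ⋯ φ_{N-1}(x_{N-1})`. -/
def orderedProd (φ : ℕ → R → E) (x : Fin N → R) : E :=
  (List.ofFn fun i : Fin N => φ i (x i)).prod

/-- The value of `orderedProd`, cut around the neighbouring factors `i` and `i + 1`. -/
theorem orderedProd_split (i r : ℕ) (φ : ℕ → R → E) (x : Fin (i + (2 + r)) → R) :
    orderedProd φ x =
      (List.ofFn fun j : Fin i => φ j (x (j.castAdd _))).prod *
        (φ i (x ⟨i, by omega⟩) * φ (i + 1) (x ⟨i + 1, by omega⟩)) *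
        (List.ofFn fun j : Fin r => φ (i + 2 + j) (x ⟨i + 2 + j, by omega⟩)).prod := by
  rw [orderedProd, List.ofFn_add, List.prod_append, List.ofFn_add, List.prod_append]
  simp [List.ofFn_succ, mul_assoc, Fin.natAdd, Fin.castAdd, Fin.castLE, add_assoc]

/-- If the factors `i` and `i + 1` may exchange their variables, then the antisymmetrization
vanishes. -/
theorem alternate_orderedProd_eq_zero (φ : ℕ → R → E) (i : ℕ) (hi : i + 1 < N)
    (h : ∀ a b, φ i a * φ (i + 1) b = φ i b * φ (i + 1) a) (x : Fin N → R) :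
    alternate (orderedProd φ) x = 0 := by
  obtain ⟨r, rfl⟩ : ∃ r, N = i + (2 + r) := ⟨N - (i + 2), by omega⟩
  refine alternate_eq_zero _ ⟨i, by omega⟩ ⟨i + 1, hi⟩ (by simp) (fun x => ?_) x
  rw [orderedProd_split, orderedProd_split, h]
  have h1 : ∀ j : Fin i, Equiv.swap (⟨i, by omega⟩ : Fin (i + (2 + r))) ⟨i + 1, hi⟩
      (j.castAdd (2 + r)) = j.castAdd (2 + r) := fun j =>
    Equiv.swap_apply_of_ne_of_ne (by simp [Fin.ext_iff]; omega) (by simp [Fin.ext_iff]; omega)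
  have h2 : ∀ j : Fin r, Equiv.swap (⟨i, by omega⟩ : Fin (i + (2 + r))) ⟨i + 1, hi⟩
      ⟨i + 2 + j, by omega⟩ = ⟨i + 2 + j, by omega⟩ := fun j =>
    Equiv.swap_apply_of_ne_of_ne (by simp [Fin.ext_iff]; omega) (by simp [Fin.ext_iff]; omega)
  simp [h1, h2]

theorem orderedProd_sub (φ ψ χ : ℕ → R → E) (i : ℕ) (hi : i + 1 < N)
    (h : ∀ a, φ (i + 1) a = ψ (i + 1) a - χ (i + 1) a)
    (h' : ∀ j, j ≠ i + 1 → φ j = ψ j ∧ φ j = χ j) (x : Fin N → R) :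
    orderedProd φ x = orderedProd ψ x - orderedProd χ x := by
  obtain ⟨r, rfl⟩ : ∃ r, N = i + (2 + r) := ⟨N - (i + 2), by omega⟩
  simp only [orderedProd_split]
  have e1 : ∀ j : Fin i, ψ j = φ j ∧ χ j = φ j := fun j =>
    ⟨(h' j (by omega)).1.symm, (h' j (by omega)).2.symm⟩
  have e2 : ∀ j : Fin r, ψ (i + 2 + j) = φ (i + 2 + j) ∧ χ (i + 2 + j) = φ (i + 2 + j) := fun j =>
    ⟨(h' _ (by omega)).1.symm, (h' _ (by omega)).2.symm⟩
  simp only [fun j => (e1 j).1, fun j => (e1 j).2, fun j => (e2 j).1, fun j => (e2 j).2, h,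
    ← (h' i (by omega)).1, ← (h' i (by omega)).2]
  simp only [mul_sub, sub_mul]

variable [CommRing R] [Algebra R E]

/-- The `j`-th factor `x_j ^ (N - 1 - j) • (1 + x_j u_0) ⋯ (1 + x_j u_{c_j - 1})` of a product of
ascending products, weighted by the staircase monomial. -/
def weightedFactor (N : ℕ) (u : ℕ → E) (c : ℕ → ℕ) (j : ℕ) (a : R) : E :=
  a ^ (N - 1 - j) • ascProd u (c j) a

variable {u : ℕ → E}

/-- Under antisymmetrization, neighbouring factors of orders `k + 1` and `k` may be replaced by
factors of orders `k + 1` and `k + 1`: the difference is symmetric in the two variables. -/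
theorem NilCoxeterRel.alternate_raise (hu : NilCoxeterRel u) (c c' : ℕ → ℕ) (i : ℕ)
    (hi : i + 1 < N) (hc : c i = c (i + 1) + 1) (hc' : c' (i + 1) = c i)
    (h' : ∀ j, j ≠ i + 1 → c' j = c j) (x : Fin N → R) :
    alternate (orderedProd (weightedFactor N u c)) x =
      alternate (orderedProd (weightedFactor N u c')) x := by
  set k := c (i + 1) with hk
  -- `ascProd u k a = ascProd u (k + 1) a - a • (ascProd u (k + 1) a * u k)`; the extra factor `a`
  -- evens out the weights of the two variables, so that the second summand gives a symmetric
  -- product.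
  let χ : ℕ → R → E := fun j => if j = i + 1 then
    fun a => a ^ (N - 1 - i) • (ascProd u (k + 1) a * u k) else weightedFactor N u c j
  have key : (orderedProd (weightedFactor N u c) : (Fin N → R) → E) =
      fun x => orderedProd (weightedFactor N u c') x - orderedProd χ x := by
    funext x
    refine orderedProd_sub _ _ _ i hi (fun a => ?_) (fun j hj => ⟨?_, ?_⟩) x
    · have e : N - 1 - i = N - 1 - (i + 1) + 1 := by omega
      simp only [weightedFactor, χ, if_true, ← hk, hc', hc, e]
      rw [← hu.ascProd_succ_mul_factor_neg k a, nilFactor, mul_add, mul_one, smul_add, neg_smul,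
        mul_neg, mul_smul_comm, smul_neg, smul_smul, ← pow_succ, ← sub_eq_add_neg]
    · funext a; simp [weightedFactor, h' j hj]
    · simp [χ, hj]
  rw [key, alternate_sub, alternate_orderedProd_eq_zero χ i hi, sub_zero]
  intro a b
  simp only [χ, if_true, Nat.left_eq_add, one_ne_zero, if_false, weightedFactor, hc,
    smul_mul_smul_comm, ← mul_assoc, hu.ascProd_comm (k + 1) a b, mul_comm (a ^ (N - 1 - i))]

/-- The orders `M, M - 1, M - 2, …` (truncated at `0`) of the ascending products may all be raised
to `M` under the antisymmetrization. -/
theorem NilCoxeterRel.alternate_staircase (hu : NilCoxeterRel u) (M : ℕ) (x : Fin N → R) :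
    alternate (orderedProd (weightedFactor N u fun j => M - j)) x =
      alternate (orderedProd (weightedFactor N u fun _ => M)) x := by
  -- The factors `> k` are raised by one in a sweep from right to left; each sweep turns the
  -- orders `M - (j - k)` into `M - (j - (k + 1))`.
  have sweep : ∀ k t, alternate (orderedProd (weightedFactor N u fun j => M - (j - k))) x =
      alternate (orderedProd (weightedFactor N u fun j =>
        if j + t < N then M - (j - k) else M - (j - (k + 1)))) x := by
    intro k t
    induction t with
    | zero =>
      congr 1
      funext y
      simp only [orderedProd, weightedFactor]
      congr 2
      funext j
      simp [j.2]
    | succ t ih =>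
      rw [ih]
      set c : ℕ → ℕ := fun j => if j + t < N then M - (j - k) else M - (j - (k + 1)) with hc
      set c' : ℕ → ℕ :=
        fun j => if j + (t + 1) < N then M - (j - k) else M - (j - (k + 1)) with hc'
      by_cases hcc : c = c'
      · rw [hcc]
      · -- the only index where `c` and `c'` may differ is `N - 1 - t`
        have hne : c (N - 1 - t) ≠ c' (N - 1 - t) := by
          intro h
          refine hcc (funext fun j => ?_)
          by_cases hj : j = N - 1 - t
          · rw [hj, h]
          · simp only [hc, hc']
            split_ifs <;> omega
        have hlt : t < N := by
          by_contra hlt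
          simp only [hc, hc'] at hne
          split_ifs at hne <;> omega
        simp only [hc, hc'] at hne
        rw [if_pos (by omega), if_neg (by omega)] at hne
        refine hu.alternate_raise c c' (N - 1 - t - 1) (by omega) ?_ ?_ ?_ x
        · simp only [hc]
          split_ifs <;> omega
        · simp only [hc, hc']
          split_ifs <;> omega
        · intro j hj
          simp only [hc, hc']
          split_ifs <;> omega
  have all : ∀ k, alternate (orderedProd (weightedFactor N u fun j => M - j)) x =
      alternate (orderedProd (weightedFactor N u fun j => M - (j - k))) x := by
    intro k
    induction k with
    | zero => simp
    | succ k ih =>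
      rw [ih, sweep k N]
      simp
  rw [all N]
  congr 1
  funext y
  simp only [orderedProd, weightedFactor]
  congr 2
  funext j
  simp [Nat.sub_eq_zero_of_le j.2.le]

theorem orderedProd_smul (f : ℕ → R → R) (φ : ℕ → R → E) (x : Fin N → R) :
    orderedProd (fun j a => f j a • φ j a) x = (∏ j : Fin N, f j (x j)) • orderedProd φ x := by
  induction N with
  | zero => simp [orderedProd]
  | succ N ih =>
    have := ih (fun j : Fin N => x j.castSucc)
    simp only [orderedProd, List.ofFn_succ', List.concat_eq_append, List.prod_append,
      List.prod_singleton, Fin.prod_univ_castSucc, Fin.val_castSucc, Fin.val_last] at this ⊢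
    rw [this, smul_mul_smul_comm]

theorem orderedProd_weightedFactor (c : ℕ → ℕ) (x : Fin N → R) :
    orderedProd (weightedFactor N u c) x =
      (∏ j : Fin N, x j ^ (N - 1 - j)) • orderedProd (fun j => ascProd u (c j)) x :=
  orderedProd_smul (fun j a => a ^ (N - 1 - j)) (fun j => ascProd u (c j)) x

/-- The alternant `det (x_i ^ l_j)`. -/
def alternant (l : ℕ → ℕ) (x : Fin N → R) : R :=
  (Matrix.of fun i j : Fin N => x i ^ l j).det

theorem alternant_eq_sum (l : ℕ → ℕ) (x : Fin N → R) :
    alternant l x = ∑ σ : Equiv.Perm (Fin N), Equiv.Perm.sign σ • ∏ j, x (σ j) ^ l j := by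
  simp [alternant, Matrix.det_apply]

/-- A product of ascending products of equal orders is symmetric, hence it can be taken out of the
antisymmetrization, which leaves the Vandermonde alternant. -/
theorem NilCoxeterRel.alternate_const (hu : NilCoxeterRel u) (M : ℕ) (x : Fin N → R) :
    alternate (orderedProd (weightedFactor N u fun _ => M)) x =
      alternant (fun j => N - 1 - j) x • orderedProd (fun _ => ascProd u M) x := by
  simp only [alternate, orderedProd_weightedFactor, alternant_eq_sum, Finset.sum_smul]
  refine Finset.sum_congr rfl fun σ _ => ?_
  rw [smul_assoc]
  congr 2
  simp only [orderedProd]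
  have hp : (List.ofFn fun i => ascProd u M ((x ∘ σ) i)).Perm
      (List.ofFn fun i => ascProd u M (x i)) := by
    simpa [Function.comp_def] using σ.ofFn_comp_perm (fun i => ascProd u M (x i))
  refine hp.prod_eq' ?_
  rw [List.pairwise_ofFn]
  intro i j _
  exact hu.ascProd_comm M _ _

end Alternation

/-! ### The nilCoxeter algebra of the symmetric group -/

section NilCoxeter

variable {m : ℕ}

theorem simpleReflection_mul_self (c : Fin (m - 1)) :
    simpleReflection c * simpleReflection c = 1 := Equiv.swap_mul_self _ _

theorem simpleReflection_comm (c d : Fin (m - 1)) (h : c.val + 2 ≤ d.val) :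
    simpleReflection c * simpleReflection d = simpleReflection d * simpleReflection c := by
  refine (Equiv.Perm.Disjoint.commute (Equiv.Perm.disjoint_swap_swap ?_)).eq
  simp
  omega

theorem simpleReflection_braid (c d : Fin (m - 1)) (h : d.val = c.val + 1) :
    simpleReflection c * simpleReflection d * simpleReflection c =
      simpleReflection d * simpleReflection c * simpleReflection d := by
  obtain ⟨d, hd⟩ := d
  obtain rfl : d = c.val + 1 := h
  simp only [simpleReflection]
  have hx : ∀ a b e : Fin m, a ≠ b → a ≠ e → b ≠ e → Equiv.swap a b * Equiv.swap b e *
      Equiv.swap a b = Equiv.swap b e * Equiv.swap a b * Equiv.swap b e := by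
    intro a b e hab hae hbe
    rw [Equiv.swap_mul_swap_mul_swap hab hae, Equiv.swap_comm a b, Equiv.swap_comm b e,
      Equiv.swap_mul_swap_mul_swap hbe.symm hae.symm, Equiv.swap_comm]
  exact hx _ _ _ (by simp) (by simp; omega) (by simp)

theorem length_one : length (1 : Equiv.Perm (Fin m)) = 0 := by
  rw [length, Finset.card_eq_zero, Finset.filter_eq_empty_iff]
  rintro p - ⟨h1, h2⟩
  exact lt_asymm h1 h2

theorem length_mul_simpleReflection_le (v : Equiv.Perm (Fin m)) (c : Fin (m - 1)) :
    length (v * simpleReflection c) ≤ length v + 1 := by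
  set s := simpleReflection c with hs
  rw [length, length]
  refine (Finset.card_le_card (t := insert (⟨c.val, by omega⟩, ⟨c.val + 1, by omega⟩)
    ((Finset.univ.filter fun p : Fin m × Fin m => p.1 < p.2 ∧ v p.2 < v p.1).image
      fun p => (s p.1, s p.2))) ?_).trans
    ((Finset.card_insert_le _ _).trans (Nat.add_le_add_right Finset.card_image_le 1))
  rintro ⟨p, q⟩ h
  replace h := (Finset.mem_filter.1 h).2
  simp only [Equiv.Perm.coe_mul, Function.comp_apply] at h
  rw [Finset.mem_insert, or_iff_not_imp_left]
  intro hne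
  have hss : ∀ i, s (s i) = i := fun i => Equiv.swap_apply_self _ _ i
  refine Finset.mem_image.2 ⟨(s p, s q), ?_, by simp [hss]⟩
  simp only [Finset.mem_filter, Finset.mem_univ, true_and]
  refine ⟨?_, h.2⟩
  have h1 := h.1
  simp only [Prod.mk.injEq, not_and, Fin.ext_iff] at hne
  simp only [hs, simpleReflection, Equiv.swap_apply_def, Fin.lt_def, Fin.ext_iff] at h1 ⊢
  split_ifs <;> simp <;> omega

theorem length_mul_prod_le (v : Equiv.Perm (Fin m)) (a : List (Fin (m - 1))) :
    length (v * (a.map simpleReflection).prod) ≤ length v + a.length := by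
  induction a generalizing v with
  | nil => simp
  | cons c a ih =>
    have h1 := ih (v * simpleReflection c)
    have h2 := length_mul_simpleReflection_le v c
    simp only [List.map_cons, List.prod_cons, List.length_cons, ← mul_assoc] at h1 ⊢
    omega

variable (m) (R : Type*) [CommRing R]

/-- The generator `u_c` of the nilCoxeter algebra, as a matrix indexed by permutations: it maps `v`
to `v s_c` if this increases the length, and to `0` otherwise. It is `0` if `s_c` does not
exist in `S_m`. -/
def nilGen (c : ℕ) : Matrix (Equiv.Perm (Fin m)) (Equiv.Perm (Fin m)) R :=
  if h : c < m - 1 then Matrix.of fun v w =>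
    if v * simpleReflection ⟨c, h⟩ = w ∧ length w = length v + 1 then 1 else 0
  else 0

variable {m R}

theorem prod_nilGen_apply (a : List (Fin (m - 1))) (v w : Equiv.Perm (Fin m)) :
    (a.map fun c : Fin (m - 1) => nilGen m R c).prod v w =
      if v * (a.map simpleReflection).prod = w ∧ length w = length v + a.length then 1 else 0 := by
  induction a generalizing v with
  | nil =>
    simp only [List.map_nil, List.prod_nil, Matrix.one_apply, mul_one, List.length_nil, add_zero]
    refine if_congr ⟨fun h => ⟨h, h ▸ rfl⟩, fun h => h.1⟩ rfl rfl
  | cons c a ih =>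
    rw [List.map_cons, List.prod_cons, Matrix.mul_apply]
    simp only [ih]
    simp only [nilGen, c.2, dif_pos, Matrix.of_apply, Fin.eta, List.map_cons, List.prod_cons,
      List.length_cons, ← mul_assoc]
    rw [Finset.sum_eq_single (v * simpleReflection c)]
    · rw [ite_zero_mul_ite_zero, one_mul]
      refine if_congr ⟨fun h => ⟨h.2.1, by have := h.1.2; have := h.2.2; omega⟩, fun h => ?_⟩
        rfl rfl
      have h1 := length_mul_simpleReflection_le v c
      have h2 := length_mul_prod_le (v * simpleReflection c) a
      rw [h.1] at h2
      have h3 := h.2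
      exact ⟨⟨rfl, by omega⟩, h.1, by omega⟩
    · intro b _ hb
      rw [if_neg (fun h => hb h.1.symm), zero_mul]
    · simp

theorem prod_nilGen_one_apply (a : List (Fin (m - 1))) (w : Equiv.Perm (Fin m))
    [Decidable (IsReducedWord w a)] :
    (a.map fun c : Fin (m - 1) => nilGen m R c).prod 1 w = if IsReducedWord w a then 1 else 0 := by
  rw [prod_nilGen_apply]
  refine if_congr ?_ rfl rfl
  rw [IsReducedWord, one_mul, length_one, zero_add, eq_comm (a := length w)]

variable (m R)

theorem nilCoxeterRel_nilGen : NilCoxeterRel (nilGen m R) where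
  sq c := by
    by_cases h : c < m - 1
    · ext v w
      have := prod_nilGen_apply (R := R) [⟨c, h⟩, ⟨c, h⟩] v w
      simp only [List.map_cons, List.map_nil, List.prod_cons, List.prod_nil, mul_one,
        simpleReflection_mul_self] at this
      rw [this, Matrix.zero_apply, if_neg]
      rintro ⟨rfl, h⟩
      simp at h
    · simp [nilGen, h]
  comm c d hcd := by
    by_cases h : d < m - 1
    · ext v w
      have h1 := prod_nilGen_apply (R := R) [⟨c, by omega⟩, ⟨d, h⟩] v w
      have h2 := prod_nilGen_apply (R := R) [⟨d, h⟩, ⟨c, by omega⟩] v w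
      simp only [List.map_cons, List.map_nil, List.prod_cons, List.prod_nil, mul_one,
        List.length_cons, List.length_nil] at h1 h2
      rw [h1, h2, simpleReflection_comm _ _ hcd]
    · simp [nilGen, h]
  braid c := by
    by_cases h : c + 1 < m - 1
    · ext v w
      have h1 := prod_nilGen_apply (R := R) [⟨c, by omega⟩, ⟨c + 1, h⟩, ⟨c, by omega⟩] v w
      have h2 := prod_nilGen_apply (R := R) [⟨c + 1, h⟩, ⟨c, by omega⟩, ⟨c + 1, h⟩] v w
      simp only [List.map_cons, List.map_nil, List.prod_cons, List.prod_nil, mul_one,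
        List.length_cons, List.length_nil, ← mul_assoc] at h1 h2
      have hb := simpleReflection_braid (m := m) ⟨c, by omega⟩ ⟨c + 1, h⟩ rfl
      rw [h1, h2, mul_assoc v, mul_assoc v, hb, ← mul_assoc v, ← mul_assoc v]
    · simp [nilGen, h]

end NilCoxeter

/-! ### A reduced word of the longest permutation -/

section LongestPerm

variable {m : ℕ}

theorem length_longestPerm : length (longestPerm m) = ∑ i ∈ Finset.range m, (m - 1 - i) := by
  have h : length (longestPerm m) = ∑ i : Fin m, (m - 1 - i) := by
    rw [length, Finset.card_eq_sum_card_fiberwise (t := Finset.univ) (f := Prod.fst) (by simp)]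
    refine Finset.sum_congr rfl fun i _ => ?_
    rw [← Fin.card_Ioi]
    refine Finset.card_bij (fun p _ => p.2) ?_ ?_ ?_
    · rintro ⟨p, q⟩ h
      simp only [Finset.mem_filter, Finset.mem_univ, true_and] at h
      obtain ⟨h, rfl⟩ := h
      simpa using h.1
    · rintro ⟨p, q⟩ h ⟨p', q'⟩ h' e
      simp only [Finset.mem_filter, Finset.mem_univ, true_and] at h h' e
      simp [h.2, h'.2, e]
    · intro j hj
      refine ⟨(i, j), ?_, rfl⟩
      simpa [longestPerm] using hj
  rw [h, Fin.sum_univ_eq_sum_range (fun i => m - 1 - i)]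

/-- The ascending word `0 1 ⋯ (k - 1)`, for `k ≤ m - 1`; a letter `c` stands for `s_c`. -/
def ascWord (m k : ℕ) : List (Fin (m - 1)) :=
  (List.finRange (m - 1)).filter fun c => c.val < k

theorem mem_ascWord {k : ℕ} {c : Fin (m - 1)} : c ∈ ascWord m k ↔ c.val < k := by
  simp [ascWord]

theorem pairwise_ascWord (m k : ℕ) : (ascWord m k).Pairwise (· < ·) :=
  (List.pairwise_lt_finRange _).filter _

theorem ascWord_map_val {k : ℕ} (hk : k ≤ m - 1) : (ascWord m k).map Fin.val = List.range k := by
  have h : (ascWord m k).map Fin.val = (List.range (m - 1)).filter fun c => c < k := by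
    rw [ascWord, ← List.map_coe_finRange_eq_range, List.filter_map]
    rfl
  obtain ⟨r, hr⟩ := Nat.exists_eq_add_of_le hk
  rw [h, hr, List.range_add, List.filter_append, List.filter_eq_self.2 (by simp),
    List.filter_eq_nil_iff.2 (by simp), List.append_nil]

theorem length_ascWord {k : ℕ} (hk : k ≤ m - 1) : (ascWord m k).length = k := by
  rw [← List.length_map (f := Fin.val), ascWord_map_val hk, List.length_range]

theorem ascWord_zero : ascWord m 0 = [] := by simp [ascWord]

theorem ascWord_succ {k : ℕ} (hk : k < m - 1) : ascWord m (k + 1) = ascWord m k ++ [⟨k, hk⟩] := by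
  apply List.map_injective_iff.2 Fin.val_injective
  rw [List.map_append, ascWord_map_val hk, ascWord_map_val hk.le, List.range_succ]
  rfl

/-- The product of the ascending word `0 1 ⋯ (k - 1)` is the cycle `0 ↦ 1 ↦ ⋯ ↦ k ↦ 0`. -/
theorem prod_ascWord_apply {k : ℕ} (hk : k ≤ m - 1) (j : Fin m) :
    (((ascWord m k).map simpleReflection).prod j).val =
      if j.val < k then j.val + 1 else if j.val = k then 0 else j.val := by
  induction k generalizing j with
  | zero => simp [ascWord_zero]
  | succ k ih =>
    rw [ascWord_succ hk, List.map_append, List.prod_append, Equiv.Perm.mul_apply, ih (by omega)]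
    simp only [List.map_cons, List.map_nil, List.prod_cons, List.prod_nil, mul_one,
      simpleReflection, Equiv.swap_apply_def, Fin.ext_iff]
    split_ifs <;> simp_all <;> omega

/-- The concatenation of the ascending words of lengths `t, t - 1, t - 2, …`; these are `N` words,
the last of them being empty if `t < N`. -/
def revWord (m t N : ℕ) : List (Fin (m - 1)) :=
  (List.finRange N).flatMap fun i : Fin N => ascWord m (t - i)

/-- The word `(0 1 ⋯ (t-1)) (0 1 ⋯ (t-2)) ⋯ (0 1) (0)` reverses `{0, …, t}`. -/
theorem prod_revWord_apply {t N : ℕ} (ht : t ≤ m - 1) (hN : t ≤ N) (j : Fin m) :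
    (((revWord m t N).map simpleReflection).prod j).val =
      if j.val ≤ t then t - j.val else j.val := by
  induction t generalizing N with
  | zero =>
    have : revWord m 0 N = [] := by simp [revWord, ascWord_zero]
    simp only [this, List.map_nil, List.prod_nil, Equiv.Perm.one_apply]
    split_ifs <;> omega
  | succ t ih =>
    obtain ⟨N, rfl⟩ : ∃ N', N = N' + 1 := ⟨N - 1, by omega⟩
    have h : revWord m (t + 1) (N + 1) = ascWord m (t + 1) ++ revWord m t N := by
      simp [revWord, List.finRange_succ, List.flatMap_map]
    rw [h, List.map_append, List.prod_append, Equiv.Perm.mul_apply, prod_ascWord_apply ht,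
      ih (by omega) (by omega)]
    split_ifs <;> omega

theorem length_revWord {N : ℕ} (hN : m ≤ N) :
    (revWord m (m - 1) N).length = length (longestPerm m) := by
  rw [length_longestPerm, revWord, List.length_flatMap]
  simp only [length_ascWord (Nat.sub_le (m - 1) _)]
  rw [← List.ofFn_eq_map, List.sum_ofFn, Fin.sum_univ_eq_sum_range (fun i => m - 1 - i)]
  refine (Finset.sum_subset (Finset.range_subset_range.2 hN) fun i _ hi => ?_).symm
  rw [Finset.mem_range] at hi
  omega

theorem isReducedWord_revWord {N : ℕ} (hN : m ≤ N) :
    IsReducedWord (longestPerm m) (revWord m (m - 1) N) := by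
  refine ⟨Equiv.ext fun j => Fin.ext ?_, length_revWord hN⟩
  rw [prod_revWord_apply le_rfl (by omega), if_pos (by omega), longestPerm, Fin.revPerm_apply,
    Fin.val_rev]
  omega

end LongestPerm

/-! ### Expansion of products in the nilCoxeter algebra -/

section Expansion

/-- Noncommutative expansion of a product of factors `1 + f p` over the sublists. -/
theorem prod_map_one_add {E ι : Type*} [Semiring E] (f : ι → E) (l : List ι) :
    (l.map fun p => 1 + f p).prod = (l.sublists'.map fun s => (s.map f).prod).sum := by
  induction l with
  | nil => simp
  | cons p l ih =>
    simp [List.sublists'_cons, ih, add_mul, Function.comp_def, List.sum_map_mul_left]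

variable {m N : ℕ} {R : Type*} [CommRing R]

/-- The pairs `(i, c)` with `i < N` and `c < k_i`, in lexicographic order. -/
def lexPairs (m N : ℕ) (k : ℕ → ℕ) : List (Fin N × Fin (m - 1)) :=
  (List.finRange N).flatMap fun i : Fin N => (ascWord m (k i)).map fun c => (i, c)

theorem mem_lexPairs {k : ℕ → ℕ} {p : Fin N × Fin (m - 1)} :
    p ∈ lexPairs m N k ↔ p.2.val < k p.1 := by
  obtain ⟨i, c⟩ := p
  simp [lexPairs, mem_ascWord]

theorem pairwise_lexPairs (k : ℕ → ℕ) :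
    (lexPairs m N k).Pairwise fun p q => p.1 < q.1 ∨ p.1 = q.1 ∧ p.2 < q.2 := by
  rw [lexPairs, List.pairwise_flatMap]
  constructor
  · intro i _
    rw [List.pairwise_map]
    exact List.Pairwise.imp (fun h => Or.inr ⟨rfl, h⟩) (pairwise_ascWord m _)
  · refine List.Pairwise.imp (fun h p hp q hq => ?_) (List.pairwise_lt_finRange N)
    obtain ⟨c, -, rfl⟩ := List.mem_map.1 hp
    obtain ⟨d, -, rfl⟩ := List.mem_map.1 hq
    exact Or.inl h

theorem nodup_lexPairs (k : ℕ → ℕ) : (lexPairs m N k).Nodup := by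
  refine (pairwise_lexPairs k).imp ?_
  rintro p q h rfl
  rcases h with h | h
  · exact lt_irrefl _ h
  · exact lt_irrefl _ h.2

theorem lexPairs_map_snd (t : ℕ) :
    (lexPairs m N fun i => t - i).map Prod.snd = revWord m t N := by
  simp [lexPairs, revWord, List.map_flatMap, Function.comp_def]

theorem prod_lexPairs_fst {k : ℕ → ℕ} (hk : ∀ i, k i ≤ m - 1) (x : Fin N → R) :
    ((lexPairs m N k).map fun p => x p.1).prod = ∏ i, x i ^ k i := by
  simp only [lexPairs, List.map_flatMap, List.map_map, Function.comp_def, List.map_const',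
    length_ascWord (hk _)]
  rw [List.flatMap, List.prod_flatten, List.map_map, ← List.ofFn_eq_map, List.prod_ofFn]
  simp

open scoped Classical in
/-- The entry `(1, w)` of an ordered product of ascending products is a sum over the reduced
words of `w`, decorated with positions. -/
theorem orderedProd_ascProd_apply {k : ℕ → ℕ} (hk : ∀ i, k i ≤ m - 1) (x : Fin N → R)
    (w : Equiv.Perm (Fin m)) :
    orderedProd (fun j => ascProd (nilGen m R) (k j)) x 1 w =
      ∑ s ∈ (lexPairs m N k).sublists'.toFinset with IsReducedWord w (s.map Prod.snd),
        (s.map fun p => x p.1).prod := by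
  have h1 : orderedProd (fun j => ascProd (nilGen m R) (k j)) x =
      ((lexPairs m N k).map fun p => 1 + x p.1 • nilGen m R p.2).prod := by
    rw [orderedProd, lexPairs, List.map_flatMap, List.flatMap, List.prod_flatten, List.map_map,
      List.ofFn_eq_map]
    congr 2
    funext i
    simp only [ascProd, nilFactor, ← ascWord_map_val (hk i), List.map_map, Function.comp_def]
  have h2 : ∀ s : List (Fin N × Fin (m - 1)), (s.map fun p => x p.1 • nilGen m R p.2).prod =
      (s.map fun p => x p.1).prod •
        ((s.map Prod.snd).map fun c : Fin (m - 1) => nilGen m R c).prod := by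
    intro s
    induction s with
    | nil => simp
    | cons p s ih => simp only [List.map_cons, List.prod_cons, ih, smul_mul_smul_comm]
  rw [h1, prod_map_one_add,
    ← List.sum_toFinset _ (List.nodup_sublists'.2 (nodup_lexPairs k)), Matrix.sum_apply,
    Finset.sum_filter]
  refine Finset.sum_congr rfl fun s _ => ?_
  rw [h2, Matrix.smul_apply, prod_nilGen_one_apply]
  simp

/-- The orders `m - 1, m - 2, …` leave no freedom: only the word `revWord`, which is as long as
`w₀`, contributes. -/
theorem orderedProd_staircase_apply (hN : m ≤ N) (x : Fin N → R) :
    orderedProd (fun j => ascProd (nilGen m R) (m - 1 - j)) x 1 (longestPerm m) =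
      ∏ j, x j ^ (m - 1 - j : ℕ) := by
  classical
  rw [orderedProd_ascProd_apply (k := fun i => m - 1 - i) (fun i => Nat.sub_le _ _),
    Finset.sum_filter, Finset.sum_eq_single (lexPairs m N fun i => m - 1 - i)]
  · rw [lexPairs_map_snd, if_pos (isReducedWord_revWord hN),
      prod_lexPairs_fst fun i => Nat.sub_le _ _]
  · intro s hs hne
    rw [if_neg]
    intro h
    refine hne ((List.mem_sublists'.1 (List.mem_toFinset.1 hs)).eq_of_length ?_)
    rw [← List.length_map (f := Prod.snd), h.2, ← length_revWord hN, ← lexPairs_map_snd,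
      List.length_map]
  · intro h
    simp at h

/-- The ordered product of the `N` full ascending products has the entry of `w₀` that satisfies
the bialternant formula of the staircase. -/
theorem alternant_mul_orderedProd_apply (hN : m ≤ N) (x : Fin N → R) :
    alternant (fun j => N - 1 - j) x *
        orderedProd (fun _ => ascProd (nilGen m R) (m - 1)) x 1 (longestPerm m) =
      alternant (fun j => m - 1 - j + (N - 1 - j)) x := by
  have h := (nilCoxeterRel_nilGen m R).alternate_staircase (m - 1) x
  rw [(nilCoxeterRel_nilGen m R).alternate_const] at h
  have h' := congrFun (congrFun h 1) (longestPerm m)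
  rw [Matrix.smul_apply, smul_eq_mul] at h'
  rw [← h', alternate, Matrix.sum_apply, alternant_eq_sum]
  refine Finset.sum_congr rfl fun σ _ => ?_
  rw [Matrix.smul_apply, orderedProd_weightedFactor, Matrix.smul_apply,
    orderedProd_staircase_apply hN, smul_eq_mul, ← Finset.prod_mul_distrib]
  simp [← pow_add, add_comm]

end Expansion

/-! ### Alternants and Schur polynomials -/

section Bialternant

variable {R : Type*} [CommRing R]

theorem det_eq_of_forall_col_eq_smul_add_succ {n : ℕ}
    {A B : Matrix (Fin (n + 1)) (Fin (n + 1)) R} (c : Fin n → R)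
    (A_last : ∀ i, A i (Fin.last n) = B i (Fin.last n))
    (A_castSucc : ∀ i (j : Fin n), A i j.castSucc = B i j.castSucc + c j * A i j.succ) :
    A.det = B.det := by
  rw [← Matrix.det_submatrix_equiv_self Fin.revPerm A,
    ← Matrix.det_submatrix_equiv_self Fin.revPerm B]
  refine Matrix.det_eq_of_forall_col_eq_smul_add_pred (fun j => c j.rev) ?_ ?_
  · intro i
    simpa using A_last i.rev
  · intro i j
    simpa [Fin.rev_succ, Fin.rev_castSucc] using A_castSucc i.rev j.rev

theorem pow_sub_pow_mul_pow (x y : R) {a b : ℕ} (h : b ≤ a) (e : ℕ) :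
    x ^ (a + (e + 1)) - y ^ (a + 1 - b) * x ^ (b + e) =
      (x - y) * ∑ t ∈ Finset.Icc b a, y ^ (a - t) * x ^ (t + e) := by
  obtain ⟨d, rfl⟩ := Nat.exists_eq_add_of_le h
  have h1 : ∑ t ∈ Finset.Icc b (b + d), y ^ (b + d - t) * x ^ (t + e) =
      x ^ (b + e) * ∑ i ∈ Finset.range (d + 1), x ^ i * y ^ (d + 1 - 1 - i) := by
    rw [← Finset.Ico_add_one_right_eq_Icc, Finset.sum_Ico_eq_sum_range, Finset.mul_sum]
    refine Finset.sum_congr (by congr 1; omega) fun i _ => ?_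
    rw [show b + d - (b + i) = d + 1 - 1 - i by omega]
    ring
  rw [h1, mul_left_comm, mul_comm (x - y), geom_sum₂_mul,
    show b + d + 1 - b = d + 1 by omega]
  ring

/-- The sequences `μ_0, …, μ_{N-1}` that interlace `l`, i.e. `l_{j+1} ≤ μ_j ≤ l_j`. -/
def interlacing (N : ℕ) (l : ℕ → ℕ) : Finset (Fin N → ℕ) :=
  Fintype.piFinset fun j : Fin N => Finset.Icc (l (j + 1)) (l j)

/-- The sequence `μ_0, …, μ_{N-1}, 0, 0, …`. -/
def extendZero {N : ℕ} (μ : Fin N → ℕ) (j : ℕ) : ℕ := if h : j < N then μ ⟨j, h⟩ else 0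

/-- The number `∑_{j ≤ N} l_j - ∑_{j < N} μ_j` of boxes of the skew shape `l / μ`, for `μ`
interlacing `l`. -/
def stripSize {N : ℕ} (l : ℕ → ℕ) (μ : Fin N → ℕ) : ℕ := ∑ j : Fin N, (l j - μ j) + l N

/-- Branching rule for alternants. Subtracting from each column a multiple of the next one, the
last row becomes `(0, …, 0, *)`, and the other entries become `x_i - x_N` times a geometric
sum. -/
theorem alternant_succ {N : ℕ} (l : ℕ → ℕ) (hl : ∀ j < N, l (j + 1) ≤ l j) (x : ℕ → R) :
    alternant (fun j => l j + (N + 1 - 1 - j)) (fun i : Fin (N + 1) => x i) =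
      (∏ i : Fin N, (x i - x N)) * ∑ μ ∈ interlacing N l,
        x N ^ stripSize l μ *
          alternant (fun j => extendZero μ j + (N - 1 - j)) (fun i : Fin N => x i) := by
  set y := x N with hy
  let B : Matrix (Fin (N + 1)) (Fin (N + 1)) R := Matrix.of fun i j =>
    if (j : ℕ) < N then
      (x i - y) * ∑ t ∈ Finset.Icc (l (j + 1)) (l j), y ^ (l j - t) * x i ^ (t + (N - 1 - j))
    else x i ^ l N
  have h1 : alternant (fun j => l j + (N + 1 - 1 - j)) (fun i : Fin (N + 1) => x i) = B.det := by
    refine det_eq_of_forall_col_eq_smul_add_succ (fun j => y ^ (l j + 1 - l (j + 1))) ?_ ?_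
    · intro i
      simp [B]
    · intro i j
      have hj := j.2
      simp only [B, Matrix.of_apply, Fin.val_castSucc, hj, if_true, Fin.val_succ]
      rw [← pow_sub_pow_mul_pow (x i) y (hl j hj), show N + 1 - 1 - j.val = N - 1 - j + 1 by omega,
        show N + 1 - 1 - (j.val + 1) = N - 1 - j by omega]
      ring
  have h2 : B.det = y ^ l N * (∏ i : Fin N, (x i - y)) * (Matrix.of fun i j : Fin N =>
      ∑ t ∈ Finset.Icc (l (j + 1)) (l j), y ^ (l j - t) * x i ^ (t + (N - 1 - j))).det := by
    rw [Matrix.det_succ_row B (Fin.last N), Finset.sum_eq_single (Fin.last N), mul_assoc _ (∏ i, _),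
      ← Matrix.det_mul_column]
    · have e : B.submatrix (Fin.last N).succAbove (Fin.last N).succAbove =
          Matrix.of fun i j : Fin N => (x i - y) * Matrix.of (fun i j : Fin N =>
            ∑ t ∈ Finset.Icc (l (j + 1)) (l j), y ^ (l j - t) * x i ^ (t + (N - 1 - j))) i j := by
        ext i j
        simp [B]
      rw [e]
      simp [B, hy]
    · intro j _ hj
      have : (j : ℕ) < N := Fin.val_lt_last hj
      simp [B, this, hy]
    · simp
  have h3 : (Matrix.of fun i j : Fin N =>
      ∑ t ∈ Finset.Icc (l (j + 1)) (l j), y ^ (l j - t) * x i ^ (t + (N - 1 - j))).det =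
      ∑ μ ∈ interlacing N l, ∑ σ : Equiv.Perm (Fin N), Equiv.Perm.sign σ •
        ∏ j : Fin N, (y ^ (l j - μ j) * x (σ j) ^ (μ j + (N - 1 - j))) := by
    rw [Matrix.det_apply]
    simp only [Matrix.of_apply, Finset.prod_univ_sum, Finset.smul_sum]
    exact Finset.sum_comm
  rw [h1, h2, h3, mul_comm (y ^ l N), mul_assoc, Finset.mul_sum]
  congr 1
  refine Finset.sum_congr rfl fun μ _ => ?_
  rw [alternant_eq_sum, stripSize, pow_add, mul_comm _ (y ^ l N), mul_assoc,
    ← Finset.prod_pow_eq_pow_sum]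
  congr 1
  rw [Finset.mul_sum]
  refine Finset.sum_congr rfl fun σ _ => ?_
  rw [Finset.prod_mul_distrib, mul_smul_comm]
  simp [extendZero]

/-- The Schur polynomial of the partition `l` in `x_0, …, x_{N-1}`, given by the branching rule
that removes the boxes of the largest entry. The sequence `l` is meant to be weakly decreasing with
`l_j = 0` for `j ≥ N`, since only then it counts tableaux. -/
def schurPoly (x : ℕ → R) : ℕ → (ℕ → ℕ) → R
  | 0, _ => 1
  | N + 1, l => ∑ μ ∈ interlacing N l, x N ^ stripSize l μ * schurPoly x N (extendZero μ)

theorem extendZero_succ_le {N : ℕ} {l : ℕ → ℕ} {μ : Fin N → ℕ} (h : μ ∈ interlacing N l) (j : ℕ) :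
    extendZero μ (j + 1) ≤ extendZero μ j := by
  simp only [interlacing, Fintype.mem_piFinset, Finset.mem_Icc] at h
  by_cases hj : j + 1 < N
  · have h1 := h ⟨j + 1, hj⟩
    have h2 := h ⟨j, by omega⟩
    simp only [extendZero, hj, dif_pos, show j < N by omega]
    exact h1.2.trans h2.1
  · simp [extendZero, hj]

/-- The bialternant formula for Schur polynomials. -/
theorem alternant_mul_schurPoly (N : ℕ) (l : ℕ → ℕ) (hl : ∀ j, l (j + 1) ≤ l j) (x : ℕ → R) :
    alternant (fun j => N - 1 - j) (fun i : Fin N => x i) * schurPoly x N l =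
      alternant (fun j => l j + (N - 1 - j)) (fun i : Fin N => x i) := by
  induction N generalizing l with
  | zero => simp [alternant, schurPoly]
  | succ N ih =>
    -- The case `l = 0` of the branching rule expresses the Vandermonde determinant in `N + 1`
    -- variables by the one in `N` variables.
    have h0 := alternant_succ (N := N) (fun _ => 0) (fun _ _ => le_rfl) x
    have h0' : interlacing N (fun _ => 0) = {fun _ => 0} := by
      ext μ
      simp [interlacing, funext_iff]
    simp only [h0', Finset.sum_singleton, stripSize, zero_add, extendZero, dite_eq_ite, ite_self,
      Nat.sub_self, Finset.sum_const_zero, pow_zero, one_mul] at h0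
    rw [h0, alternant_succ l (fun j _ => hl j), schurPoly, mul_assoc, Finset.mul_sum]
    congr 1
    refine Finset.sum_congr rfl fun μ hμ => ?_
    rw [← ih (extendZero μ) (extendZero_succ_le hμ)]
    ring

theorem alternant_staircase_ne_zero [IsDomain R] {N : ℕ} {x : Fin N → R}
    (hx : Function.Injective x) : alternant (fun j => N - 1 - j) x ≠ 0 := by
  have h : alternant (fun j => N - 1 - j) x =
      ((Matrix.vandermonde x).submatrix id Fin.revPerm).det := by
    rw [alternant]
    congr 1
    ext i j
    simp only [Matrix.of_apply, Matrix.submatrix_apply, id, Matrix.vandermonde_apply,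
      Fin.revPerm_apply, Fin.val_rev]
    congr 1
    omega
  rw [h, Matrix.det_permute']
  refine mul_ne_zero ?_ (Matrix.det_vandermonde_ne_zero_iff.2 hx)
  rcases Int.units_eq_one_or (Equiv.Perm.sign (Fin.revPerm : Equiv.Perm (Fin N))) with h | h <;>
    simp [h]

end Bialternant

/-! ### Semistandard fillings -/

section Tableaux

/-- `T` is a semistandard filling, with entries `< N`, of the shape whose `i`-th row consists of
the boxes `(i, j)` with `j < l i`; it is `0` outside this shape. -/
structure IsFilling (N : ℕ) (l : ℕ → ℕ) (T : ℕ → ℕ → ℕ) : Prop where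
  lt : ∀ i j, j < l i → T i j < N
  row : ∀ i j j', j < j' → j' < l i → T i j ≤ T i j'
  col : ∀ i i' j, i < i' → j < l i' → T i j < T i' j
  zero : ∀ i j, l i ≤ j → T i j = 0

/-- The content of a filling of the first `N` rows of the shape `l`. -/
noncomputable def fillingContent (N : ℕ) (l : ℕ → ℕ) (T : ℕ → ℕ → ℕ) : ℕ →₀ ℕ :=
  ∑ i ∈ Finset.range N, ∑ j ∈ Finset.range (l i), Finsupp.single (T i j) 1

/-- The filling obtained from a filling `T` of the shape `μ` by putting `N` into all the boxes of
`l / μ`. -/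
def fillStrip (N : ℕ) (l μ : ℕ → ℕ) (T : ℕ → ℕ → ℕ) (i j : ℕ) : ℕ :=
  if j < μ i then T i j else if j < l i then N else 0

variable {N : ℕ} {l : ℕ → ℕ}

theorem extendZero_le {μ : Fin N → ℕ} (h : μ ∈ interlacing N l) (i : ℕ) :
    extendZero μ i ≤ l i := by
  simp only [interlacing, Fintype.mem_piFinset, Finset.mem_Icc] at h
  by_cases hi : i < N
  · simpa [extendZero, hi] using (h ⟨i, hi⟩).2
  · simp [extendZero, hi]

theorem le_extendZero {μ : Fin N → ℕ} (h : μ ∈ interlacing N l) (h0 : ∀ i, N < i → l i = 0)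
    (i : ℕ) : l (i + 1) ≤ extendZero μ i := by
  simp only [interlacing, Fintype.mem_piFinset, Finset.mem_Icc] at h
  by_cases hi : i < N
  · simpa [extendZero, hi] using (h ⟨i, hi⟩).1
  · simp [h0 (i + 1) (by omega)]

theorem IsFilling.fillStrip {μ : Fin N → ℕ} {T : ℕ → ℕ → ℕ} (h0 : ∀ i, N < i → l i = 0)
    (hl : Antitone l) (hμ : μ ∈ interlacing N l) (hT : IsFilling N (extendZero μ) T) :
    IsFilling (N + 1) l (fillStrip N l (extendZero μ) T) where
  lt i j hj := by
    have := hT.lt i j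
    simp only [StanleySym.fillStrip]
    split_ifs <;> omega
  row i j j' hjj hj' := by
    have h1 := hT.lt i j
    have h2 := hT.row i j j' hjj
    simp only [StanleySym.fillStrip]
    split_ifs <;> omega
  col i i' j hii hj := by
    have h1 := le_extendZero hμ h0 i
    have h2 : l i' ≤ l (i + 1) := hl hii
    have h3 := hT.col i i' j hii
    have h4 := hT.lt i j
    simp only [StanleySym.fillStrip]
    split_ifs <;> omega
  zero i j hj := by
    have := extendZero_le hμ i
    simp only [StanleySym.fillStrip]
    split_ifs <;> omega

theorem fillingContent_fillStrip {μ : Fin N → ℕ} (T : ℕ → ℕ → ℕ) (hμ : μ ∈ interlacing N l) :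
    fillingContent (N + 1) l (fillStrip N l (extendZero μ) T) =
      fillingContent N (extendZero μ) T + Finsupp.single N (stripSize l μ) := by
  have row : ∀ i, ∑ j ∈ Finset.range (l i),
      Finsupp.single (fillStrip N l (extendZero μ) T i j) 1 =
      ∑ j ∈ Finset.range (extendZero μ i), Finsupp.single (T i j) 1 +
        Finsupp.single N (l i - extendZero μ i) := by
    intro i
    obtain ⟨r, hr⟩ := Nat.exists_eq_add_of_le (extendZero_le hμ i)
    rw [hr, Finset.sum_range_add]
    congr 1
    · refine Finset.sum_congr rfl fun j hj => ?_
      rw [fillStrip, if_pos (Finset.mem_range.1 hj)]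
    · rw [Finset.sum_congr rfl (g := fun _ => Finsupp.single N 1)]
      · simp
      · intro j hj
        rw [Finset.mem_range] at hj
        rw [fillStrip, if_neg (by omega), if_pos (by omega)]
  have h0 : extendZero μ N = 0 := by simp [extendZero]
  have hs : stripSize l μ = ∑ i ∈ Finset.range N, (l i - extendZero μ i) + l N := by
    rw [stripSize, ← Fin.sum_univ_eq_sum_range (fun i => l i - extendZero μ i)]
    simp [extendZero]
  simp only [fillingContent, row, Finset.sum_range_succ, Finset.sum_add_distrib, h0, hs,
    Finsupp.single_add, Finset.range_zero, Finset.sum_empty, zero_add, Nat.sub_zero, add_assoc,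
    ← Finsupp.single_finsetSum]

/-- The length of the part of the row `i` that is filled with entries `< N`. -/
def rowCount (N : ℕ) (l : ℕ → ℕ) (T : ℕ → ℕ → ℕ) (i : ℕ) : ℕ :=
  ((Finset.range (l i)).filter fun j => T i j < N).card

/-- Rows are weakly increasing, so the entries `< N` of a row form an initial segment of it. -/
theorem IsFilling.lt_rowCount_iff {T : ℕ → ℕ → ℕ} (hT : IsFilling (N + 1) l T) {i j : ℕ} :
    j < rowCount N l T i ↔ j < l i ∧ T i j < N := by
  set s := (Finset.range (l i)).filter fun j => T i j < N with hs
  have hmem : ∀ j, j ∈ s ↔ j < l i ∧ T i j < N := by simp [hs]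
  have hdown : ∀ j j', j ≤ j' → j' ∈ s → j ∈ s := by
    intro j j' hjj hj'
    rw [hmem] at hj' ⊢
    rcases hjj.eq_or_lt with rfl | hjj
    · exact hj'
    · exact ⟨by omega, (hT.row i j j' hjj hj'.1).trans_lt hj'.2⟩
  rw [← hmem, show rowCount N l T i = s.card from rfl]
  constructor
  · intro hj
    by_contra hjs
    have : s ⊆ Finset.range j := fun j' hj' => by
      rw [Finset.mem_range]
      by_contra hle
      exact hjs (hdown j j' (by omega) hj')
    have := Finset.card_le_card this
    rw [Finset.card_range] at this
    omega
  · intro hj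
    have : Finset.range (j + 1) ⊆ s := fun j' hj' => hdown j' j (by simp at hj'; omega) hj
    have := Finset.card_le_card this
    rw [Finset.card_range] at this
    omega

/-- Columns are strict, so the entries of row `i` are at least `i`. -/
theorem IsFilling.le_entry {T : ℕ → ℕ → ℕ} (hT : IsFilling N l T) (hl : Antitone l) {i j : ℕ}
    (hj : j < l i) : i ≤ T i j := by
  induction i with
  | zero => exact Nat.zero_le _
  | succ i ih =>
    have h1 := ih (hj.trans_le (hl i.le_succ))
    have h2 := hT.col i (i + 1) j i.lt_succ_self hj
    omega

theorem IsFilling.rowCount_mem {T : ℕ → ℕ → ℕ} (hT : IsFilling (N + 1) l T) (hl : Antitone l) :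
    (fun i : Fin N => rowCount N l T i) ∈ interlacing N l := by
  simp only [interlacing, Fintype.mem_piFinset, Finset.mem_Icc]
  intro i
  constructor
  · by_contra h
    push Not at h
    have h1 := hT.lt (i + 1) _ h
    have h2 := hT.col i (i + 1) _ (Nat.lt_succ_self _) h
    exact lt_irrefl _ (hT.lt_rowCount_iff.2 ⟨h.trans_le (hl (Nat.le_succ i)), by omega⟩)
  · exact (Finset.card_filter_le _ _).trans (by simp)

theorem IsFilling.extendZero_rowCount {T : ℕ → ℕ → ℕ} (hT : IsFilling (N + 1) l T)
    (hl : Antitone l) : extendZero (fun i : Fin N => rowCount N l T i) = rowCount N l T := by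
  funext i
  by_cases hi : i < N
  · simp [extendZero, hi]
  · simp only [extendZero, hi, dif_neg, not_false_eq_true]
    by_contra h
    have h1 := hT.lt_rowCount_iff.1 (Nat.pos_of_ne_zero (Ne.symm h))
    have := hT.le_entry hl h1.1
    omega

/-- Semistandard fillings of `l` with entries `≤ N` correspond to semistandard fillings with
entries `< N` of shapes interlacing `l`. -/
theorem bijective_fillStrip (h0 : ∀ i, N < i → l i = 0) (hl : Antitone l) :
    Function.Bijective (fun p : Σ μ : interlacing N l, {T // IsFilling N (extendZero μ.1) T} =>
      (⟨fillStrip N l (extendZero p.1.1) p.2.1, p.2.2.fillStrip h0 hl p.1.2⟩ :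
        {T // IsFilling (N + 1) l T})) := by
  constructor
  · rintro ⟨⟨μ, hμ⟩, T, hT⟩ ⟨⟨μ', hμ'⟩, T', hT'⟩ h
    simp only [Subtype.mk.injEq] at h
    have key : ∀ (μ : Fin N → ℕ) (T : ℕ → ℕ → ℕ), μ ∈ interlacing N l →
        IsFilling N (extendZero μ) T → ∀ i j, j < extendZero μ i ↔
          j < l i ∧ fillStrip N l (extendZero μ) T i j < N := by
      intro μ T hμ hT i j
      have h1 := extendZero_le hμ i
      have h2 := hT.lt i j
      simp only [fillStrip]
      split_ifs <;> omega
    have hμμ : extendZero μ = extendZero μ' := by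
      funext i
      have h1 : ∀ j, j < extendZero μ i ↔ j < extendZero μ' i := fun j => by
        rw [key μ T hμ hT, key μ' T' hμ' hT', h]
      exact le_antisymm (not_lt.1 fun h => lt_irrefl _ ((h1 _).1 h))
        (not_lt.1 fun h => lt_irrefl _ ((h1 _).2 h))
    obtain rfl : μ = μ' := by
      funext i
      simpa [extendZero] using congrFun hμμ i
    obtain rfl : T = T' := by
      funext i j
      have := congrFun (congrFun h i) j
      simp only [fillStrip] at this
      by_cases hj : j < extendZero μ i
      · simpa [hj] using this
      · rw [hT.zero i j (not_lt.1 hj), hT'.zero i j (not_lt.1 hj)]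
    rfl
  · rintro ⟨T, hT⟩
    have he := hT.extendZero_rowCount hl
    refine ⟨⟨⟨fun i => rowCount N l T i, hT.rowCount_mem hl⟩,
      fun i j => if j < rowCount N l T i then T i j else 0, ?_⟩, ?_⟩
    · rw [he]
      have hc := fun i j => hT.lt_rowCount_iff (i := i) (j := j)
      constructor
      · intro i j hj
        rw [if_pos hj]
        exact ((hc i j).1 hj).2
      · intro i j j' hjj hj'
        rw [if_pos (hjj.trans hj'), if_pos hj']
        exact hT.row i j j' hjj ((hc i j').1 hj').1
      · intro i i' j hii hj
        have h1 := (hc i' j).1 hj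
        have h2 := hT.col i i' j hii h1.1
        rw [if_pos ((hc i j).2 ⟨h1.1.trans_le (hl hii.le), h2.trans h1.2⟩), if_pos hj]
        exact h2
      · intro i j hj
        rw [if_neg (by omega)]
    · apply Subtype.ext
      funext i j
      simp only [he, fillStrip]
      have hc := hT.lt_rowCount_iff (i := i) (j := j)
      have h1 := hT.lt i j
      have h2 := hT.zero i j
      split_ifs <;> omega

theorem finite_isFilling (hl : Antitone l) (h0 : ∀ i, N ≤ i → l i = 0) :
    Finite {T // IsFilling N l T} := by
  induction N generalizing l with
  | zero =>
    have : Subsingleton {T // IsFilling 0 l T} := ⟨fun T T' => by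
      apply Subtype.ext
      funext i j
      rw [T.2.zero i j (by simp [h0]), T'.2.zero i j (by simp [h0])]⟩
    infer_instance
  | succ N ih =>
    have (μ : interlacing N l) : Finite {T // IsFilling N (extendZero μ.1) T} :=
      ih (antitone_nat_of_succ_le (extendZero_succ_le μ.2)) fun i hi => by
        simp [extendZero, hi.not_gt]
    exact Finite.of_surjective _ (bijective_fillStrip h0 hl).2

/-- The Schur polynomial is the generating function of the semistandard fillings. -/
theorem schurPoly_X (hl : Antitone l) (h0 : ∀ i, N ≤ i → l i = 0)
    [Fintype {T // IsFilling N l T}] :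
    schurPoly (MvPolynomial.X : ℕ → MvPolynomial ℕ ℤ) N l =
      ∑ T : {T // IsFilling N l T}, MvPolynomial.monomial (fillingContent N l T.1) 1 := by
  induction N generalizing l with
  | zero =>
    have hz : IsFilling 0 l fun _ _ => 0 := by
      constructor <;> simp [h0]
    rw [Fintype.sum_eq_single ⟨_, hz⟩]
    · simp [schurPoly, fillingContent]
    · intro T hT
      refine (hT (Subtype.ext ?_)).elim
      funext i j
      rw [T.2.zero i j (by simp [h0])]
  | succ N ih =>
    have hl' (μ : interlacing N l) : Antitone (extendZero μ.1) :=
      antitone_nat_of_succ_le (extendZero_succ_le μ.2)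
    have h0' (μ : interlacing N l) : ∀ i, N ≤ i → extendZero μ.1 i = 0 := fun i hi => by
      simp [extendZero, hi.not_gt]
    have (μ : interlacing N l) : Fintype {T // IsFilling N (extendZero μ.1) T} :=
      have := finite_isFilling (hl' μ) (h0' μ)
      Fintype.ofFinite _
    rw [← (Equiv.ofBijective _ (bijective_fillStrip h0 hl)).sum_comp, Fintype.sum_sigma, schurPoly,
      ← Finset.sum_coe_sort]
    refine Finset.sum_congr rfl fun μ _ => ?_
    rw [ih (hl' μ) (h0' μ), Finset.mul_sum]
    refine Finset.sum_congr rfl fun T _ => ?_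
    rw [Equiv.ofBijective_apply, fillingContent_fillStrip _ μ.2, MvPolynomial.X_pow_eq_monomial,
      MvPolynomial.monomial_mul, add_comm, one_mul]

theorem fillingContent_rowLen (μ : YoungDiagram) (hN : ∀ i, N ≤ i → μ.rowLen i = 0)
    (T : ℕ → ℕ → ℕ) :
    fillingContent N μ.rowLen T = ∑ c ∈ μ.cells, Finsupp.single (T c.1 c.2) 1 := by
  rw [fillingContent, Finset.sum_finset_product μ.cells (Finset.range N)
    fun i => Finset.range (μ.rowLen i)]
  rintro ⟨i, j⟩
  rw [YoungDiagram.mem_cells, YoungDiagram.mem_iff_lt_rowLen, Finset.mem_range, Finset.mem_range]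
  refine ⟨fun h => ⟨?_, h⟩, fun h => h.2⟩
  by_contra hi
  simp [hN i (by omega)] at h

/-- The coefficients of the Schur function are those of the Schur polynomial in sufficiently many
variables. -/
theorem schurFunction_eq_coeff (μ : YoungDiagram) (d : ℕ →₀ ℕ)
    (hN : ∀ i, N ≤ i → μ.rowLen i = 0) (hd : ∀ k ∈ d.support, k < N) :
    schurFunction μ d =
      (schurPoly (MvPolynomial.X : ℕ → MvPolynomial ℕ ℤ) N μ.rowLen).coeff d := by
  classical
  have hl : Antitone μ.rowLen := fun i i' h => μ.rowLen_anti i i' h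
  have := finite_isFilling hl hN
  have := Fintype.ofFinite {T // IsFilling N μ.rowLen T}
  have hmem : ∀ {i j}, (i, j) ∈ μ ↔ j < μ.rowLen i := YoungDiagram.mem_iff_lt_rowLen
  rw [schurPoly_X hl hN, MvPolynomial.coeff_sum]
  simp only [MvPolynomial.coeff_monomial]
  rw [Finset.sum_boole, ← Fintype.card_subtype, ← Nat.card_eq_fintype_card, schurFunction]
  congr 1
  refine Nat.card_congr
    { toFun := fun T => ⟨⟨T.1, ?_⟩, ?_⟩
      invFun := fun T => ⟨⟨T.1.1, ?_, ?_, ?_⟩, ?_⟩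
      left_inv := fun T => rfl
      right_inv := fun T => rfl }
  · obtain ⟨T, hT⟩ := T
    constructor
    · intro i j hj
      refine hd _ ?_
      change T i j ∈ d.support
      rw [Finsupp.mem_support_iff, ← DFunLike.congr_fun hT, content, Finsupp.finsetSum_apply]
      intro h
      have := Finset.sum_eq_zero_iff.1 h (i, j) (hmem.2 hj)
      simp at this
    · exact fun i j j' hjj hj' => T.row_weak hjj (hmem.2 hj')
    · exact fun i i' j hii hj => T.col_strict hii (hmem.2 hj)
    · exact fun i j hj => T.zeros (by rw [hmem]; omega)
  · rw [fillingContent_rowLen μ hN]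
    exact T.2
  · exact fun hjj hj' => T.1.2.row _ _ _ hjj (hmem.1 hj')
  · exact fun hii hj => T.1.2.col _ _ _ hii (hmem.1 hj)
  · intro i j hj
    exact T.1.2.zero _ _ (by rw [hmem] at hj; omega)
  · exact (fillingContent_rowLen μ hN T.1.1).symm.trans T.2

end Tableaux

/-! ### Stanley's series -/

section StanleySeries

variable {m N : ℕ}

theorem exponent_cons (k : ℕ) (i : List ℕ) :
    exponent (k :: i) = Finsupp.single k 1 + exponent i := by simp [exponent]

theorem exponent_apply_ne_zero {k : ℕ} {i : List ℕ} (h : k ∈ i) : exponent i k ≠ 0 := by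
  induction i with
  | nil => simp at h
  | cons a i ih =>
    rw [exponent_cons, Finsupp.add_apply]
    rcases List.mem_cons.1 h with rfl | h
    · simp
    · have := ih h
      omega

theorem prod_map_X (i : List ℕ) :
    (i.map (MvPolynomial.X : ℕ → MvPolynomial ℕ ℤ)).prod =
      MvPolynomial.monomial (exponent i) 1 := by
  induction i with
  | nil => simp [exponent]
  | cons k i ih =>
    rw [List.map_cons, List.prod_cons, ih, exponent_cons, MvPolynomial.X,
      MvPolynomial.monomial_mul, one_mul]

/-- Neighbouring letters of a reduced word are distinct. -/
theorem IsReducedWord.isChain_ne {w : Equiv.Perm (Fin m)} {a : List (Fin (m - 1))}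
    (ha : IsReducedWord w a) : a.IsChain (· ≠ ·) := by
  classical
  rw [List.isChain_iff_getElem]
  intro j hj heq
  have hsplit : a = a.take j ++ a[j] :: a[j + 1] :: a.drop (j + 2) := by
    rw [← List.drop_eq_getElem_cons, ← List.drop_eq_getElem_cons, List.take_append_drop]
  have h1 := prod_nilGen_one_apply (R := ℤ) a w
  rw [if_pos ha, hsplit, ← heq, List.map_append, List.prod_append, List.map_cons, List.map_cons,
    List.prod_cons, List.prod_cons, ← mul_assoc (nilGen m ℤ _), (nilCoxeterRel_nilGen m ℤ).sq] at h1
  simp at h1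

theorem isCompatible_iff_isChain {s : List (Fin N × Fin (m - 1))}
    (hs : (s.map Prod.snd).IsChain (· ≠ ·)) :
    IsCompatible (s.map Prod.snd) (s.map fun p => p.1.val) ↔
      s.IsChain fun p q => p.1 < q.1 ∨ p.1 = q.1 ∧ p.2 < q.2 := by
  rw [List.isChain_iff_getElem] at hs ⊢
  simp only [IsCompatible, List.length_map, List.getElem_map, true_and] at hs ⊢
  have key : ∀ j (hj : j + 1 < s.length),
      (s[j].1.val ≤ s[j + 1].1.val ∧ (s[j + 1].2 < s[j].2 → s[j].1.val < s[j + 1].1.val)) ↔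
        (s[j].1 < s[j + 1].1 ∨ s[j].1 = s[j + 1].1 ∧ s[j].2 < s[j + 1].2) := by
    intro j hj
    have := hs j hj
    simp only [Fin.lt_def, Fin.ext_iff, ne_eq] at this ⊢
    omega
  exact ⟨fun h j hj => (key j hj).1 (h j hj hj), fun h j hj _ => (key j hj).2 (h j hj)⟩

theorem mem_sublists'_lexPairs {s : List (Fin N × Fin (m - 1))} :
    s ∈ (lexPairs m N fun _ => m - 1).sublists' ↔
      s.IsChain fun p q => p.1 < q.1 ∨ p.1 = q.1 ∧ p.2 < q.2 := by
  have : IsTrans (Fin N × Fin (m - 1)) fun p q => p.1 < q.1 ∨ p.1 = q.1 ∧ p.2 < q.2 :=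
    ⟨fun p q r h h' => by simp only [Fin.lt_def, Fin.ext_iff] at h h' ⊢; omega⟩
  have : Std.Antisymm fun p q : Fin N × Fin (m - 1) => p.1 < q.1 ∨ p.1 = q.1 ∧ p.2 < q.2 :=
    ⟨fun p q h h' => by simp only [Fin.lt_def, Fin.ext_iff] at h h'; omega⟩
  rw [List.mem_sublists', List.isChain_iff_pairwise]
  refine ⟨fun h => (pairwise_lexPairs _).sublist h, fun h => ?_⟩
  refine List.sublist_of_subperm_of_pairwise (List.Nodup.subperm ?_ ?_) h (pairwise_lexPairs _)
  · refine h.imp ?_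
    rintro p q h rfl
    simp at h
  · intro p _
    exact mem_lexPairs.2 p.2.2

/-- The coefficients of Stanley's series are those of an entry of the ordered product of
sufficiently many ascending products in the nilCoxeter algebra. -/
theorem stanleyF_eq_coeff (w : Equiv.Perm (Fin m)) (d : ℕ →₀ ℕ) (hd : ∀ k ∈ d.support, k < N) :
    stanleyF w d =
      (orderedProd (fun _ => ascProd (nilGen m (MvPolynomial ℕ ℤ)) (m - 1))
        (fun i : Fin N => (MvPolynomial.X i : MvPolynomial ℕ ℤ)) 1 w).coeff d := by
  classical
  have hX : ∀ s : List (Fin N × Fin (m - 1)),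
      (s.map fun p => (MvPolynomial.X p.1 : MvPolynomial ℕ ℤ)).prod =
        MvPolynomial.monomial (exponent (s.map fun p => p.1.val)) 1 := fun s => by
    rw [← prod_map_X, List.map_map]
    rfl
  rw [orderedProd_ascProd_apply (k := fun _ => m - 1) (fun _ => le_rfl), MvPolynomial.coeff_sum]
  simp only [hX, MvPolynomial.coeff_monomial]
  rw [Finset.sum_boole, ← Nat.card_eq_finsetCard, stanleyF]
  congr 1
  symm
  have hmem : ∀ s : List (Fin N × Fin (m - 1)),
      s ∈ ((lexPairs m N fun _ => m - 1).sublists'.toFinset.filter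
        fun s => IsReducedWord w (s.map Prod.snd)).filter
        (fun s => exponent (s.map fun p => p.1.val) = d) ↔
      IsReducedWord w (s.map Prod.snd) ∧
        IsCompatible (s.map Prod.snd) (s.map fun p => p.1.val) ∧
        exponent (s.map fun p => p.1.val) = d := by
    intro s
    simp only [Finset.mem_filter, List.mem_toFinset, mem_sublists'_lexPairs]
    constructor
    · rintro ⟨⟨h1, h2⟩, h3⟩
      exact ⟨h2, (isCompatible_iff_isChain h2.isChain_ne).2 h1, h3⟩
    · rintro ⟨h2, h1, h3⟩
      exact ⟨⟨(isCompatible_iff_isChain h2.isChain_ne).1 h1, h2⟩, h3⟩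
  refine Nat.card_eq_of_bijective
    (fun s => ⟨(s.1.map Prod.snd, s.1.map fun p => p.1.val), (hmem s.1).1 s.2⟩) ⟨?_, ?_⟩
  · rintro ⟨s, hs⟩ ⟨s', hs'⟩ h
    simp only [Subtype.mk.injEq, Prod.mk.injEq] at h ⊢
    obtain ⟨h1, h2⟩ := h
    have hlen : s.length = s'.length := by simpa using congrArg List.length h1
    refine List.ext_getElem hlen fun j hj hj' => ?_
    have e1 := List.getElem_of_eq h1 (i := j) (by simpa using hj)
    have e2 := List.getElem_of_eq h2 (i := j) (by simpa using hj)
    simp only [List.getElem_map] at e1 e2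
    exact Prod.ext (Fin.ext e2) e1
  · rintro ⟨⟨a, i⟩, ha, hc, he⟩
    have hlt : ∀ k ∈ i, k < N := fun k hk =>
      hd k (Finsupp.mem_support_iff.2 (he ▸ exponent_apply_ne_zero hk))
    let s : List (Fin N × Fin (m - 1)) := (i.attach.map fun k => ⟨k.1, hlt k.1 k.2⟩).zip a
    have hs1 : s.map Prod.snd = a := List.map_snd_zip (by simpa using hc.1.ge)
    have hs2 : (s.map fun p => p.1.val) = i := by
      have : (s.map fun p => p.1.val) = (s.map Prod.fst).map Fin.val := by simp
      rw [this, List.map_fst_zip (by simpa using hc.1.le), List.map_map]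
      exact i.attach_map_subtype_val
    refine ⟨⟨s, (hmem s).2 ?_⟩, ?_⟩
    · rw [hs1, hs2]
      exact ⟨ha, hc, he⟩
    · simp only [hs1, hs2]

theorem stanleyF_longestPerm : stanleyF (longestPerm m) = schurFunction (staircase m) := by
  funext d
  obtain ⟨N, hmN, hd⟩ : ∃ N, m ≤ N ∧ ∀ k ∈ d.support, k < N :=
    ⟨max m (d.support.sup id + 1), le_max_left _ _, fun k hk =>
      lt_max_of_lt_right (Nat.lt_succ_of_le (Finset.le_sup (f := id) hk))⟩
  rw [stanleyF_eq_coeff _ d hd,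
    schurFunction_eq_coeff _ d (fun i hi => by rw [rowLen_staircase]; omega) hd]
  congr 1
  have hinj : Function.Injective fun i : Fin N => (MvPolynomial.X i : MvPolynomial ℕ ℤ) :=
    MvPolynomial.X_injective.comp Fin.val_injective
  apply mul_left_cancel₀ (alternant_staircase_ne_zero hinj)
  rw [alternant_mul_orderedProd_apply hmN, alternant_mul_schurPoly N _
    (fun j => (staircase m).rowLen_anti _ _ j.le_succ) MvPolynomial.X]
  simp only [rowLen_staircase]

end StanleySeries

/-! ### Squarefree coefficients -/

section Squarefree

variable {m : ℕ}

theorem exponent_range (n : ℕ) :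
    exponent (List.range n) = ∑ k ∈ Finset.range n, Finsupp.single k 1 := by
  rw [exponent, Finset.sum_range, ← List.sum_ofFn, List.ofFn_eq_map,
    ← List.map_coe_finRange_eq_range, List.map_map]
  rfl

theorem sum_single_range_apply (n k : ℕ) :
    (∑ j ∈ Finset.range n, Finsupp.single j 1 : ℕ →₀ ℕ) k = if k < n then 1 else 0 := by
  simp [Finsupp.finsetSum_apply, Finsupp.single_apply]

theorem exponent_apply (i : List ℕ) (k : ℕ) : exponent i k = i.count k := by
  induction i with
  | nil => simp [exponent]
  | cons a i ih =>
    rw [exponent_cons, Finsupp.add_apply, ih, List.count_cons, Finsupp.single_apply, add_comm]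
    simp

/-- The only weakly increasing sequence with exponent `x_0 x_1 ⋯ x_{n-1}` is `0, 1, …, n - 1`. -/
theorem isCompatible_and_exponent_iff {p n : ℕ} {a : List (Fin p)} {i : List ℕ}
    (ha : a.length = n) :
    IsCompatible a i ∧ exponent i = ∑ k ∈ Finset.range n, Finsupp.single k 1 ↔
      i = List.range n := by
  constructor
  · rintro ⟨⟨h1, h2⟩, h3⟩
    have hs : i.Pairwise (· ≤ ·) := by
      rw [← List.isChain_iff_pairwise, List.isChain_iff_getElem]
      exact fun j hj => (h2 j (by omega) hj).1
    refine List.Perm.eq_of_pairwise (le := (· ≤ ·)) (fun _ _ _ _ => le_antisymm) hs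
      (List.pairwise_le_range) ?_
    rw [List.perm_iff_count]
    intro k
    rw [← exponent_apply, h3, ← exponent_range, exponent_apply]
  · rintro rfl
    refine ⟨⟨by simp [ha], fun j _ _ => ?_⟩, exponent_range n⟩
    simp

/-- The coefficient of `x_0 x_1 ⋯ x_{ℓ-1}` in Stanley's series is the number of reduced words. -/
theorem stanleyF_squarefree (w : Equiv.Perm (Fin m)) :
    stanleyF w (∑ k ∈ Finset.range (length w), Finsupp.single k 1) =
      Nat.card {a : List (Fin (m - 1)) // IsReducedWord w a} := by
  rw [stanleyF]
  congr 1
  refine Nat.card_congr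
    { toFun := fun p => ⟨p.1.1, p.2.1⟩
      invFun := fun a => ⟨(a.1, List.range (length w)), a.2,
        (isCompatible_and_exponent_iff a.2.2).2 rfl⟩
      left_inv := ?_
      right_inv := fun a => rfl }
  rintro ⟨⟨a, i⟩, ha, hi⟩
  obtain rfl := (isCompatible_and_exponent_iff ha.2).1 hi
  rfl

/-- The coefficient of `x_0 x_1 ⋯ x_{n-1}`, for `n = |μ|`, in the Schur function is the number of
standard tableaux. -/
theorem schurFunction_squarefree (μ : YoungDiagram) :
    schurFunction μ (∑ k ∈ Finset.range μ.card, Finsupp.single k 1) =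
      Nat.card (StandardTableau μ) := by
  rw [schurFunction]
  congr 1
  refine Nat.card_congr (Equiv.subtypeEquivRight fun T => ?_)
  have hc : ∀ k, content T k = (μ.cells.filter fun c => T c.1 c.2 = k).card := fun k => by
    simp [content, Finsupp.finsetSum_apply, Finsupp.single_apply]
  rw [DFunLike.ext_iff]
  simp only [hc, sum_single_range_apply]
  constructor
  · intro h
    refine ⟨fun c hcμ => ?_, fun c hcμ c' hcμ' e => ?_, fun k hk => ?_⟩
    · by_contra hlt
      have h0 := Finset.card_eq_zero.1 ((h (T c.1 c.2)).trans (if_neg hlt))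
      exact Finset.notMem_empty c (h0 ▸ Finset.mem_filter.2 ⟨hcμ, rfl⟩)
    · have h1 : (μ.cells.filter fun b => T b.1 b.2 = T c.1 c.2).card ≤ 1 := by
        rw [h]
        split_ifs <;> simp
      exact Finset.card_le_one.1 h1 c (Finset.mem_filter.2 ⟨hcμ, rfl⟩) c'
        (Finset.mem_filter.2 ⟨hcμ', e.symm⟩)
    · have h1 := (h k).trans (if_pos hk)
      obtain ⟨c, hc⟩ := Finset.card_pos.1 (h1.symm ▸ one_pos)
      rw [Finset.mem_filter] at hc
      exact ⟨c, hc.1, hc.2⟩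
  · rintro ⟨hmaps, hinj, hsurj⟩ k
    split_ifs with hk
    · obtain ⟨c, hcμ, rfl⟩ := hsurj hk
      refine Finset.card_eq_one.2 ⟨c, ?_⟩
      ext b
      rw [Finset.mem_filter, Finset.mem_singleton]
      exact ⟨fun hb => hinj hb.1 hcμ hb.2, fun hb => by rw [hb]; exact ⟨hcμ, rfl⟩⟩
    · rw [Finset.card_eq_zero, Finset.filter_eq_empty_iff]
      rintro c hcμ rfl
      exact hk (hmaps hcμ)

theorem card_staircase : (staircase m).card = length (longestPerm m) := by
  have h : (staircase m).card = ∑ i ∈ Finset.range m, ∑ _j ∈ Finset.range (m - 1 - i), 1 := by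
    rw [YoungDiagram.card, Finset.card_eq_sum_ones]
    refine Finset.sum_finset_product _ _ (fun i => Finset.range (m - 1 - i)) fun p => ?_
    simp only [staircase, Finset.mem_filter, Finset.mem_product, Finset.mem_range]
    omega
  simp [h, length_longestPerm]

end Squarefree

end StanleySym

theorem mainTheorem3 (m : ℕ) :
    StanleySym.stanleyF (StanleySym.longestPerm m)
        = StanleySym.schurFunction (StanleySym.staircase m) ∧
      Nat.card {a : List (Fin (m - 1)) // StanleySym.IsReducedWord (StanleySym.longestPerm m) a}
        = Nat.card (StanleySym.StandardTableau (StanleySym.staircase m)) := by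
  refine ⟨StanleySym.stanleyF_longestPerm, ?_⟩
  have h := StanleySym.schurFunction_squarefree (StanleySym.staircase m)
  rw [← StanleySym.stanleyF_longestPerm, StanleySym.card_staircase,
    StanleySym.stanleyF_squarefree] at h
  exact_mod_cast h
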